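/- Machine model. A deterministic MPC has $M$ machines, each with a local memory of $S$ words, where a word is an integer in $\{0,\dots,(n+2)^c-1\}$ for a constant $c$, i.e. it has $O(\log n)$ bits. The computation is synchronous. In every round each machine performs an arbitrary deterministic local computation on the content of its memory, which may depend on $n$, on the index of the machine and on the number of the round, and then the machines exchange messages; in each round a machine sends at most $S$ words in total, and the words it keeps together with those it receives must fit into its $S$ words of memory. The global space is $S\cdot M$. Theorem. For every constant $\delta>0$ there are constants $C,c,R$ (depending only on $\delta$) and, for every $n\ge 1$, a deterministic MPC program with words in $\{0,\dots,(n+2)^c-1\}$, local space $S\le C n^{\delta}$ and global space $S\cdot M\le C n$ (with room for $n$ edges, that is, $M\lfloor S/2\rfloor\ge n$), such that the following holds. Let $G$ be any undirected simple graph with vertex set $\{0,\dots,n-1\}$, $m$ edges and maximum degree at most $2$, whose edges are initially distributed arbitrarily among the machines (each edge is stored on exactly one machine as a pair of words, its endpoints in either order, and each machine holds at most $S$ words). Then after $R$ rounds, during which all the above space and communication limits are respected, the memories of the machines contain exactly lists of edges (two words per edge), and the set of all edges so listed is a matching of $G$ of size at least $\frac{m}{8}$. -/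

import Mathlib

/-- A deterministic program for an MPC with `M` machines. A local memory is a list of words, and
words are natural numbers (their size is bounded in `MPCProgram.RunsWithin`). In round `t`, machine
`i` with local memory `mem` performs an arbitrary local computation: it retains the words
`keep t i mem` and sends the words `send t i mem j` to machine `j`. -/
structure MPCProgram (M : ℕ) where
  keep : ℕ → Fin M → List ℕ → List ℕ
  send : ℕ → Fin M → List ℕ → Fin M → List ℕ

namespace MPCProgram

variable {M : ℕ}

/-- One synchronous round: afterwards, the memory of machine `j` consists of the words that it has
retained, followed by the words that it has received, in the order of the senders. -/
def round (P : MPCProgram M) (t : ℕ) (mem : Fin M → List ℕ) : Fin M → List ℕ := fun j =>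
  P.keep t j (mem j) ++ (List.finRange M).flatMap fun i => P.send t i (mem i) j

/-- The local memories after `t` rounds, started from the local memories `init`. -/
def run (P : MPCProgram M) (init : Fin M → List ℕ) : ℕ → Fin M → List ℕ
  | 0 => init
  | t + 1 => P.round t (P.run init t)

/-- During its first `R` rounds from `init`, the program respects local space of `S` words, where
a word is a number below `B`: every local memory (input, retained and received words, output)
always has at most `S` words, and no machine sends more than `S` words in a round. -/
def RunsWithin (P : MPCProgram M) (S B R : ℕ) (init : Fin M → List ℕ) : Prop :=
  (∀ t ≤ R, ∀ i, (P.run init t i).length ≤ S ∧ ∀ w ∈ P.run init t i, w < B) ∧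
    ∀ t < R, ∀ i, ∑ j, (P.send t i (P.run init t i) j).length ≤ S

end MPCProgram

/-- A list of edges written as words: two words, the endpoints, for each edge. -/
def encodeEdges {n : ℕ} (l : List (Fin n × Fin n)) : List ℕ :=
  l.flatMap fun e => [e.1.val, e.2.val]

/-- The set of undirected edges that are listed on some machine. -/
def listedEdges {n M : ℕ} (L : Fin M → List (Fin n × Fin n)) : Set (Sym2 (Fin n)) :=
  {e | ∃ i, ∃ p ∈ L i, s(p.1, p.2) = e}

/-- The edge set of `G` is distributed among `M` machines with local space `S`: every edge of `G`
is listed exactly once in total (on an arbitrary machine, in an arbitrary order, with its endpoints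
in either order), nothing else is listed, and the list of every machine fits into its space. -/
def IsEdgeDistribution {n M : ℕ} (G : SimpleGraph (Fin n)) (S : ℕ)
    (L : Fin M → List (Fin n × Fin n)) : Prop :=
  listedEdges L = G.edgeSet ∧
    ((List.finRange M).flatMap fun i => (L i).map fun p => s(p.1, p.2)).Nodup ∧
    ∀ i, (encodeEdges (L i)).length ≤ S

/-! Colour the vertices by a bipartition `g`. Every `true` vertex with a `false` neighbour proposes
to one such neighbour, and every vertex receiving proposals accepts one. The accepted edges form a
matching, and since degrees are at most 2 it has at least half as many edges as there are proposers
(`exists_matching_of_proposals`). For uniform `g` a vertex of degree 1 proposes with probability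
1/4, one of degree 2 with probability 3/8; both are at least deg/8, so about m/4 proposers, hence
m/8 edges, are expected.

To derandomize, a fixed family of 8h bipartitions, with h a multiple of n^(1/k), replaces the random
one. A tail bound and a union bound over triples of vertices give a family in which each vertex of
degree d proposes for at least d·h of the 8h seeds (`exists_bipartition_family`,
`degree_mul_le_card_seeds`). The gap between the expectations 2h, 3h and the thresholds h, 2h pays
for the union bound, so averaging over seeds loses nothing: the best seed has at least m/4 proposers
(`card_edgeFinset_le_crossing`). The program may depend on n, so the family is built into it.

With q about n^(1/k) and 2/k ≤ δ, each machine owns q² vertices. The counts for all seeds are added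
along a tree of fan-in q and depth k and the best seed is broadcast back, in a constant number of
rounds. One machine handles O(q²) arcs and q children with O(q) counts each, so O(q²) = O(n^δ) words
suffice (`runsWithin_program`). -/

/-! ### Random bipartitions and a small derandomizing family. -/

theorem two_mul_card_filter_apply_eq {n : ℕ} (u : Fin n) (b : Bool) (Q : (Fin n → Bool) → Prop)
    [DecidablePred Q] (hQ : ∀ g c, Q (Function.update g u c) ↔ Q g) :
    2 * (Finset.univ.filter fun g : Fin n → Bool => g u = b ∧ Q g).card =
      (Finset.univ.filter Q).card := by
  -- Flipping the bit at `u` exchanges the two halves, because `Q` ignores that bit.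
  have h1 : (Finset.univ.filter fun g : Fin n → Bool => g u = b ∧ Q g).card =
      (Finset.univ.filter fun g : Fin n → Bool => g u ≠ b ∧ Q g).card := by
    refine Finset.card_bij' (fun g _ => Function.update g u (!g u))
      (fun g _ => Function.update g u (!g u)) ?_ ?_ ?_ ?_
    · intro g hg
      simp only [Finset.mem_filter, Finset.mem_univ, true_and, hQ] at hg ⊢
      refine ⟨?_, hg.2⟩
      simp [hg.1]
    · intro g hg
      simp only [Finset.mem_filter, Finset.mem_univ, true_and, hQ] at hg ⊢
      refine ⟨?_, hg.2⟩
      have := hg.1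
      simp only [Function.update_self]
      revert this
      cases g u <;> cases b <;> simp
    · intro g _; simp
    · intro g _; simp
  have h2 := Finset.card_filter_add_card_filter_not (s := Finset.univ.filter Q)
    (fun g : Fin n → Bool => g u = b)
  rw [Finset.filter_filter, Finset.filter_filter] at h2
  simp only [and_comm, ne_eq] at h1 h2 ⊢
  omega

theorem card_filter_pair {n : ℕ} {u v : Fin n} (h : v ≠ u) :
    4 * (Finset.univ.filter fun g : Fin n → Bool => g u = true ∧ g v = false).card = 2 ^ n := by
  have h1 := two_mul_card_filter_apply_eq u true (fun g => g v = false)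
    (fun g c => by simp [Function.update_of_ne h])
  have h2 := two_mul_card_filter_apply_eq v false (fun _ => True) (fun _ _ => Iff.rfl)
  simp only [and_true, Finset.filter_true, Finset.card_univ, Fintype.card_pi, Fintype.card_bool,
    Finset.prod_const, Fintype.card_fin] at h2
  omega

theorem card_filter_triple {n : ℕ} {u v w : Fin n} (hv : v ≠ u) (hw : w ≠ u) (hvw : v ≠ w) :
    8 * (Finset.univ.filter fun g : Fin n → Bool =>
      g u = true ∧ (g v = false ∨ g w = false)).card = 3 * 2 ^ n := by
  have h1 := two_mul_card_filter_apply_eq u true (fun g => g v = false ∨ g w = false)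
    (fun g c => by simp [Function.update_of_ne hv, Function.update_of_ne hw])
  have h2 := two_mul_card_filter_apply_eq v false (fun _ => True) (fun _ _ => Iff.rfl)
  simp only [and_true, Finset.filter_true, Finset.card_univ, Fintype.card_pi, Fintype.card_bool,
    Finset.prod_const, Fintype.card_fin] at h2
  have h3 := card_filter_pair hvw.symm
  -- Disjoint split into proportions 1/2 + 1/4 = 3/4; the independent condition at `u` halves this
  -- to 3/8.
  have h4 : (Finset.univ.filter fun g : Fin n → Bool => g v = false ∨ g w = false).card =
      (Finset.univ.filter fun g : Fin n → Bool => g v = false).card +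
      (Finset.univ.filter fun g : Fin n → Bool => g v = true ∧ g w = false).card := by
    rw [← Finset.card_union_of_disjoint]
    · congr 1
      ext g
      simp only [Finset.mem_filter, Finset.mem_univ, true_and, Finset.mem_union]
      cases g v <;> simp
    · rw [Finset.disjoint_filter]
      intro g _ h h'
      simp [h] at h'
  omega

/-- An exponential moment bound: the number of sequences of length `L` that hit `E` fewer than `T`
times. -/
theorem card_few_hits_le {Ω : Type*} [Fintype Ω] [DecidableEq Ω] (E : Finset Ω) (L T : ℕ) :
    ((Finset.univ.filter fun F : Fin L → Ω =>
      (Finset.univ.filter fun s => F s ∈ E).card < T).card : ℝ) ≤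
      2 ^ T * (Fintype.card Ω - E.card / 2 : ℝ) ^ L := by
  have h1 : ∀ F : Fin L → Ω, (∏ s, if F s ∈ E then (1 / 2 : ℝ) else 1) =
      (1 / 2) ^ (Finset.univ.filter fun s => F s ∈ E).card := by
    intro F
    rw [Finset.prod_ite, Finset.prod_const, Finset.prod_const_one, mul_one]
  have h2 : (∑ F : Fin L → Ω, ∏ s, if F s ∈ E then (1 / 2 : ℝ) else 1) =
      (Fintype.card Ω - E.card / 2 : ℝ) ^ L := by
    have h := Finset.prod_univ_sum (fun _ : Fin L => (Finset.univ : Finset Ω))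
      (fun _ x => if x ∈ E then (1 / 2 : ℝ) else 1)
    rw [Fintype.piFinset_univ] at h
    rw [← h, Finset.prod_const, Finset.card_univ, Fintype.card_fin]
    congr 1
    have h3 : ∀ x : Ω, (if x ∈ E then (1 / 2 : ℝ) else 1) = 1 - if x ∈ E then 1 / 2 else 0 := by
      intro x; split_ifs <;> norm_num
    simp only [h3, Finset.sum_sub_distrib, Finset.sum_ite_mem, Finset.univ_inter]
    simp [div_eq_mul_inv]
  rw [← h2, Finset.mul_sum, Finset.card_filter, Nat.cast_sum]
  -- The indicator of fewer than `T` hits is at most 2^T · 2^(-hits), and the sum of 2^(-hits) over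
  -- all sequences has just been factorized.
  refine Finset.sum_le_sum fun F _ => ?_
  rw [h1]
  split_ifs with h
  · push_cast
    rw [one_div, inv_pow, ← div_eq_mul_inv, le_div_iff₀ (by positivity), one_mul]
    exact pow_le_pow_right₀ (by norm_num) h.le
  · push_cast
    positivity

/-- A small family of vertex bipartitions behaving like triplewise independent ones. -/
theorem exists_bipartition_family (n h : ℕ) (hn : n ^ 3 * 4 ^ h < 5 ^ h) :
    ∃ f : ℕ → Fin n → Bool, ∀ u v w : Fin n, v ≠ u → w ≠ u →
      (if v = w then h else 2 * h) ≤ ((Finset.range (8 * h)).filter fun s =>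
        f s u = true ∧ (f s v = false ∨ f s w = false)).card := by
  classical
  let E : Fin n × Fin n × Fin n → Finset (Fin n → Bool) := fun p =>
    Finset.univ.filter fun g => g p.1 = true ∧ (g p.2.1 = false ∨ g p.2.2 = false)
  -- The case `v = w` encodes a vertex with one neighbour. The expected numbers of hits are 2h and
  -- 3h.
  let T : Fin n × Fin n × Fin n → ℕ := fun p => if p.2.1 = p.2.2 then h else 2 * h
  let I : Finset (Fin n × Fin n × Fin n) := Finset.univ.filter fun p => p.2.1 ≠ p.1 ∧ p.2.2 ≠ p.1
  let bad : Fin n × Fin n × Fin n → Finset (Fin (8 * h) → Fin n → Bool) := fun p =>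
    Finset.univ.filter fun F => (Finset.univ.filter fun s => F s ∈ E p).card < T p
  -- The base 4/5 dominates both 2·(7/8)^8 and 4·(13/16)^8, the moment bounds for densities 1/4 and
  -- 3/8.
  have hbad : ∀ p ∈ I, ((bad p).card : ℝ) ≤ (4 / 5) ^ h * ((2 : ℝ) ^ n) ^ (8 * h) := by
    rintro ⟨u, v, w⟩ hp
    simp only [I, Finset.mem_filter, Finset.mem_univ, true_and] at hp
    refine (card_few_hits_le (E (u, v, w)) (8 * h) (T (u, v, w))).trans ?_
    have hc : (Fintype.card (Fin n → Bool) : ℝ) = 2 ^ n := by simp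
    rw [hc]
    by_cases hvw : v = w
    · subst hvw
      have h1 : ((E (u, v, v)).card : ℝ) = 2 ^ n / 4 := by
        have := card_filter_pair hp.1
        have h2 : (4 : ℝ) * (E (u, v, v)).card = 2 ^ n := by
          simp only [E, or_self]; exact_mod_cast this
        linarith
      have h3 : T (u, v, v) = h := by simp [T]
      rw [h1, h3, show (2 : ℝ) ^ n - 2 ^ n / 4 / 2 = 7 / 8 * 2 ^ n by ring, mul_pow, ← mul_assoc,
        pow_mul (7 / 8 : ℝ), ← mul_pow]
      gcongr
      norm_num
    · have h1 : ((E (u, v, w)).card : ℝ) = 3 * 2 ^ n / 8 := by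
        have := card_filter_triple hp.1 hp.2 hvw
        have h2 : (8 : ℝ) * (E (u, v, w)).card = 3 * 2 ^ n := by
          simp only [E]; exact_mod_cast this
        linarith
      have h3 : T (u, v, w) = 2 * h := by simp [T, hvw]
      rw [h1, h3, show (2 : ℝ) ^ n - 3 * 2 ^ n / 8 / 2 = 13 / 16 * 2 ^ n by ring, mul_pow,
        ← mul_assoc, pow_mul (13 / 16 : ℝ), pow_mul (2 : ℝ), ← mul_pow]
      gcongr
      norm_num
  have hlt : ((I.biUnion bad).card : ℝ) < ((2 : ℝ) ^ n) ^ (8 * h) := by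
    calc ((I.biUnion bad).card : ℝ) ≤ ∑ p ∈ I, ((bad p).card : ℝ) := by
          exact_mod_cast Finset.card_biUnion_le
      _ ≤ ∑ p ∈ I, (4 / 5) ^ h * ((2 : ℝ) ^ n) ^ (8 * h) := Finset.sum_le_sum hbad
      _ = I.card * (4 / 5) ^ h * ((2 : ℝ) ^ n) ^ (8 * h) := by
          rw [Finset.sum_const, nsmul_eq_mul, mul_assoc]
      _ ≤ (n : ℝ) ^ 3 * (4 / 5) ^ h * ((2 : ℝ) ^ n) ^ (8 * h) := by
          gcongr
          have : I.card ≤ n ^ 3 := by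
            refine (Finset.card_le_univ I).trans (le_of_eq ?_)
            simp only [Fintype.card_prod, Fintype.card_fin]; ring
          exact_mod_cast this
      _ < 1 * ((2 : ℝ) ^ n) ^ (8 * h) := by
          gcongr
          rw [div_pow, ← mul_div_assoc, div_lt_one (by positivity)]
          exact_mod_cast hn
      _ = _ := one_mul _
  obtain ⟨F, hF⟩ : ∃ F, F ∉ I.biUnion bad := by
    by_contra! hall
    have : I.biUnion bad = Finset.univ := Finset.eq_univ_iff_forall.2 hall
    rw [this, Finset.card_univ] at hlt
    simp at hlt
  -- Seeds from 8h on are never counted, so their value is arbitrary.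
  refine ⟨fun s => if hs : s < 8 * h then F ⟨s, hs⟩ else fun _ => false, fun u v w hv hw => ?_⟩
  have h1 : F ∉ bad (u, v, w) := fun hb =>
    hF (Finset.mem_biUnion.2 ⟨(u, v, w), by simp [I, hv, hw], hb⟩)
  simp only [bad, Finset.mem_filter, Finset.mem_univ, true_and, not_lt] at h1
  refine h1.trans ?_
  refine Finset.card_le_card_of_injOn (fun s => s.val) ?_ (fun a _ b _ hab => Fin.ext hab)
  intro s hs
  simpa [E] using hs

/-- Since n < 2^(kq), it comes down to 8 · 4^12 ≤ 5^12, which is where the factor 12 in h = 12kq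
originates. An h of logarithmic size would do, but a multiple of q already fits the space bound. -/
theorem pow_three_mul_four_pow_lt {n q k : ℕ} (hn : n < q ^ k) :
    n ^ 3 * 4 ^ (12 * k * q) < 5 ^ (12 * k * q) := by
  have h1 : n < 2 ^ (k * q) := hn.trans_le <| by
    rw [mul_comm, pow_mul]
    exact Nat.pow_le_pow_left Nat.lt_two_pow_self.le k
  have h2 : n ^ 3 < (2 ^ (k * q)) ^ 3 := Nat.pow_lt_pow_left h1 (by norm_num)
  calc n ^ 3 * 4 ^ (12 * k * q) < (2 ^ (k * q)) ^ 3 * 4 ^ (12 * k * q) := by gcongr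
    _ = (2 ^ 3 * 4 ^ 12) ^ (k * q) := by
      rw [mul_pow, ← pow_mul, ← pow_mul, ← pow_mul]; congr 2 <;> ring
    _ ≤ (5 ^ 12) ^ (k * q) := Nat.pow_le_pow_left (by norm_num) _
    _ = 5 ^ (12 * k * q) := by rw [← pow_mul]; congr 1; ring

/-! ### Bounds for the integer root. -/

/-- An integer approximation of `n ^ (1 / k)`. -/
noncomputable def rootSucc (k n : ℕ) : ℕ := ⌊(n : ℝ) ^ (1 / k : ℝ)⌋₊ + 1

theorem lt_rootSucc_pow {k : ℕ} (hk : k ≠ 0) (n : ℕ) : n < rootSucc k n ^ k := by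
  have h1 : (n : ℝ) ^ (1 / k : ℝ) < (rootSucc k n : ℝ) := by
    rw [rootSucc]; push_cast; exact Nat.lt_floor_add_one _
  have h2 : ((n : ℝ) ^ (1 / k : ℝ)) ^ k < (rootSucc k n : ℝ) ^ k :=
    pow_lt_pow_left₀ h1 (by positivity) hk
  rw [one_div, Real.rpow_inv_natCast_pow (by positivity) hk] at h2
  exact_mod_cast h2

theorem rootSucc_sq_le {k n : ℕ} (hn : 1 ≤ n) :
    ((rootSucc k n : ℝ)) ^ 2 ≤ 4 * (n : ℝ) ^ (2 / k : ℝ) := by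
  have h0 : (1 : ℝ) ≤ n := by exact_mod_cast hn
  have h1 : (1 : ℝ) ≤ (n : ℝ) ^ (1 / k : ℝ) := Real.one_le_rpow h0 (by positivity)
  have h2 : (rootSucc k n : ℝ) ≤ 2 * (n : ℝ) ^ (1 / k : ℝ) := by
    rw [rootSucc]; push_cast
    have := Nat.floor_le (show 0 ≤ (n : ℝ) ^ (1 / k : ℝ) by positivity)
    linarith
  calc ((rootSucc k n : ℝ)) ^ 2 ≤ (2 * (n : ℝ) ^ (1 / k : ℝ)) ^ 2 := by gcongr
    _ = 4 * (n : ℝ) ^ (2 / k : ℝ) := by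
      rw [mul_pow, ← Real.rpow_natCast ((n : ℝ) ^ (1 / k : ℝ)), ← Real.rpow_mul (by positivity)]
      congr 1
      · norm_num
      · congr 1; push_cast; ring

theorem rootSucc_le {k n : ℕ} (hk : k ≠ 0) (hn : 1 ≤ n) : rootSucc k n ≤ n + 1 := by
  have h0 : (1 : ℝ) ≤ n := by exact_mod_cast hn
  have hk' : (1 : ℝ) ≤ k := by exact_mod_cast Nat.one_le_iff_ne_zero.2 hk
  have : (n : ℝ) ^ (1 / k : ℝ) ≤ n := by
    conv_rhs => rw [← Real.rpow_one (n : ℝ)]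
    exact Real.rpow_le_rpow_of_exponent_le h0 (by rw [div_le_one (by linarith)]; exact hk')
  rw [rootSucc]
  have := Nat.floor_le_of_le this
  omega

theorem rootSucc_sq_le_mul {k n : ℕ} (hk : 2 ≤ k) (hn : 1 ≤ n) : rootSucc k n ^ 2 ≤ 4 * n := by
  have h0 : (1 : ℝ) ≤ n := by exact_mod_cast hn
  have hk' : (2 : ℝ) ≤ k := by exact_mod_cast hk
  have h1 := rootSucc_sq_le (k := k) hn
  have h2 : (n : ℝ) ^ (2 / k : ℝ) ≤ n := by
    conv_rhs => rw [← Real.rpow_one (n : ℝ)]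
    exact Real.rpow_le_rpow_of_exponent_le h0 (by rw [div_le_one (by linarith)]; exact hk')
  have h3 : ((rootSucc k n : ℝ)) ^ 2 ≤ 4 * n := by linarith
  exact_mod_cast h3

namespace PathMatching

/-! ### The MPC program and its word formats. -/

section Program

variable {n : ℕ}

/-- The word for an arc, which is kept by the machine that owns its tail `u`. -/
def arcWord (u v : Fin n) : ℕ := Nat.pair 0 (Nat.pair u v)

/-- The word for the value `c` that is attached to the seed `s`. -/
def tallyWord (s c : ℕ) : ℕ := Nat.pair 1 (Nat.pair s c)

/-- The index of the machine that owns the vertex `v`. -/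
def owner (q : ℕ) (v : Fin n) : ℕ := v.val / q ^ 2

/-- The inverse of `encodeEdges`. -/
def decodeEdges (n : ℕ) : List ℕ → List (Fin n × Fin n)
  | a :: b :: l =>
    if h : a < n ∧ b < n then (⟨a, h.1⟩, ⟨b, h.2⟩) :: decodeEdges n l else []
  | _ => []

/-- The arcs of the listed edges with tails on machine `j`. -/
def arcsFor (q : ℕ) (j : ℕ) (p : Fin n × Fin n) : List ℕ :=
  (if owner q p.1 = j then [arcWord p.1 p.2] else []) ++
    (if owner q p.2 = j then [arcWord p.2 p.1] else [])

/-- The vertex to which `u` proposes for the bipartition `g`. -/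
def proposal (g : Fin n → Bool) (mem : List ℕ) (u : Fin n) : Option (Fin n) :=
  (List.finRange n).find? fun v => g u && !g v && decide (arcWord u v ∈ mem)

/-- The number of proposals on a machine. -/
def proposers (g : Fin n → Bool) (mem : List ℕ) : ℕ :=
  (Finset.univ.filter fun u => (proposal g mem u).isSome).card

/-- The sum of all values that are attached to the seed `s`. -/
def tally (s : ℕ) (mem : List ℕ) : ℕ :=
  (mem.map fun w =>
    if w.unpair.1 = 1 ∧ w.unpair.2.unpair.1 = s then w.unpair.2.unpair.2 else 0).sum

/-- The seed in the memory, if there is exactly one. -/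
def announced (mem : List ℕ) : ℕ :=
  (mem.map fun w => if w.unpair.1 = 1 then w.unpair.2.unpair.1 else 0).sum

open Classical in
/-- A seed below `L` for which `g` is largest. -/
noncomputable def best (L : ℕ) (g : ℕ → ℕ) : ℕ :=
  if h : ∃ s < L, ∀ s' < L, g s' ≤ g s then h.choose else 0

/-- The proposals to vertices on machine `j`. -/
def proposalsFor (q : ℕ) (g : Fin n → Bool) (mem : List ℕ) (j : ℕ) : List ℕ :=
  (List.finRange n).filterMap fun u => (proposal g mem u).bind fun v =>
    if owner q v = j then some (arcWord v u) else none

/-- The edges that are formed by accepting one proposal at every vertex. -/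
def accepted (n : ℕ) (mem : List ℕ) : List (Fin n × Fin n) :=
  (List.finRange n).filterMap fun v =>
    ((List.finRange n).find? fun u => decide (arcWord v u ∈ mem)).map fun u => (v, u)

/-- Round `0` sends all arcs to the owners of their tails. The rounds `1, …, k` add up the numbers
of proposals for every seed along a tree with fan-in `q`, the rounds `k + 1, …, 2 * k` broadcast the
best seed along the same tree. In the last two rounds, proposals for this seed are sent and
accepted. -/
noncomputable def program (M q k L : ℕ) (f : ℕ → Fin n → Bool) : MPCProgram M where
  keep t _ mem :=
    if t = 0 then [] else
    if t ≤ 2 * k then mem.filter fun w => w.unpair.1 = 0 else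
    if t = 2 * k + 1 then [] else encodeEdges (accepted n mem)
  send t i mem j :=
    if t = 0 then (decodeEdges n mem).flatMap (arcsFor q j) else
    if t ≤ k then
      if i.val / q = j then
        (List.range L).map fun s =>
          tallyWord s (if t = 1 then proposers (f s) mem else tally s mem)
      else [] else
    if t ≤ 2 * k then
      if i.val = j / q then
        [tallyWord (if t = k + 1 then best L (fun s => tally s mem) else announced mem) 0]
      else [] else
    if t = 2 * k + 1 then proposalsFor q (f (announced mem)) mem j else []

theorem decodeEdges_encodeEdges (l : List (Fin n × Fin n)) :
    decodeEdges n (encodeEdges l) = l := by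
  induction l with
  | nil => rfl
  | cons p l ih =>
    change decodeEdges n (p.1.val :: p.2.val :: encodeEdges l) = p :: l
    rw [decodeEdges, dif_pos ⟨p.1.2, p.2.2⟩, ih]

theorem length_encodeEdges (l : List (Fin n × Fin n)) :
    (encodeEdges l).length = 2 * l.length := by
  simp [encodeEdges, mul_comm]

@[simp] theorem unpair_arcWord (u v : Fin n) : (arcWord u v).unpair.1 = 0 := by simp [arcWord]

theorem arcWord_inj {u v u' v' : Fin n} : arcWord u v = arcWord u' v' ↔ u = u' ∧ v = v' := by
  simp [arcWord, Nat.pair_eq_pair, Fin.ext_iff]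

theorem arcWord_ne_tallyWord (u v : Fin n) (s c : ℕ) : arcWord u v ≠ tallyWord s c := by
  simp [arcWord, tallyWord, Nat.pair_eq_pair]

theorem best_spec {L : ℕ} (hL : 0 < L) (g : ℕ → ℕ) :
    best L g < L ∧ ∀ s < L, g s ≤ g (best L g) := by
  have h : ∃ s < L, ∀ s' < L, g s' ≤ g s := by
    obtain ⟨s, hs, h⟩ := Finset.exists_max_image (Finset.range L) g ⟨0, by simpa using hL⟩
    exact ⟨s, by simpa using hs, fun s' hs' => h s' (by simpa using hs')⟩
  rw [best, dif_pos h]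
  exact h.choose_spec

/-- In a broadcast round each machine hears from its parent only. -/
theorem flatMap_finRange_ite_eq {α : Type*} {M : ℕ} (l : Fin M → List α) {a : ℕ} (ha : a < M) :
    ((List.finRange M).flatMap fun i => if i.val = a then l i else []) = l ⟨a, ha⟩ := by
  have key : ∀ L : List (Fin M), L.Nodup →
      (L.flatMap fun i => if i.val = a then l i else []) =
        if (⟨a, ha⟩ : Fin M) ∈ L then l ⟨a, ha⟩ else [] := by
    intro L
    induction L with
    | nil => simp
    | cons b L ih =>
      intro h
      rw [List.nodup_cons] at h
      rw [List.flatMap_cons, ih h.2]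
      by_cases hb : b.val = a
      · obtain rfl : b = ⟨a, ha⟩ := Fin.ext hb
        simp [h.1]
      · have : (⟨a, ha⟩ : Fin M) ≠ b := fun h => hb (by rw [← h])
        simp [hb, this]
  rw [key _ (List.nodup_finRange M), if_pos (List.mem_finRange _)]

theorem tally_append (s : ℕ) (l l' : List ℕ) : tally s (l ++ l') = tally s l + tally s l' := by
  simp [tally]

theorem tally_flatMap {M : ℕ} (s : ℕ) (l : Fin M → List ℕ) :
    tally s ((List.finRange M).flatMap l) = ∑ i, tally s (l i) := by
  rw [Fin.sum_univ_def]
  induction List.finRange M with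
  | nil => rfl
  | cons a L ih => rw [List.flatMap_cons, tally_append, ih]; simp

theorem tally_of_arcs (s : ℕ) {l : List ℕ} (h : ∀ w ∈ l, w.unpair.1 = 0) : tally s l = 0 := by
  rw [tally, List.sum_eq_zero]
  intro x hx
  obtain ⟨w, hw, rfl⟩ := List.mem_map.1 hx
  simp [h w hw]

theorem tally_range {L s : ℕ} (hs : s < L) (c : ℕ → ℕ) :
    tally s ((List.range L).map fun s' => tallyWord s' (c s')) = c s := by
  rw [tally, List.map_map]
  have : ((List.range L).map ((fun w : ℕ => if w.unpair.1 = 1 ∧ w.unpair.2.unpair.1 = s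
      then w.unpair.2.unpair.2 else 0) ∘ fun s' => tallyWord s' (c s'))) =
      (List.range L).map fun s' => if s' = s then c s' else 0 := by
    refine List.map_congr_left fun s' _ => ?_
    simp [tallyWord]
  rw [this]
  change ∑ s' ∈ Finset.range L, (if s' = s then c s' else 0) = c s
  rw [Finset.sum_ite_eq', if_pos (Finset.mem_range.2 hs)]

theorem announced_append_tallyWord {l : List ℕ} (h : ∀ w ∈ l, w.unpair.1 = 0) (s c : ℕ) :
    announced (l ++ [tallyWord s c]) = s := by
  have h1 : announced l = 0 := by
    rw [announced, List.sum_eq_zero]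
    intro x hx
    obtain ⟨w, hw, rfl⟩ := List.mem_map.1 hx
    simp [h w hw]
  simp only [announced] at h1
  simp [announced, h1, tallyWord]

theorem filter_append_of_arcs {l l' : List ℕ} (h : ∀ w ∈ l, w.unpair.1 = 0)
    (h' : ∀ w ∈ l', w.unpair.1 ≠ 0) :
    ((l ++ l').filter fun w => decide (w.unpair.1 = 0)) = l := by
  rw [List.filter_append, List.filter_eq_self.2, List.filter_eq_nil_iff.2, List.append_nil]
  · intro w hw; simpa using h' w hw
  · intro w hw; simpa using h w hw

theorem proposal_append_tallyWord (g : Fin n → Bool) (l : List ℕ) (s c : ℕ) :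
    proposal g (l ++ [tallyWord s c]) = proposal g l := by
  funext u
  simp [proposal, arcWord_ne_tallyWord]

end Program

/-! ### Memory contents after each round. -/

section Run

variable {n M : ℕ} (q k L : ℕ) (f : ℕ → Fin n → Bool) (A : Fin M → List ℕ)

/-- The number of proposals for the seed `s` in the subtree of height `r` below machine `j`. -/
def subtotal (r : ℕ) (j : Fin M) (s : ℕ) : ℕ :=
  ∑ i ∈ Finset.univ.filter (fun i : Fin M => i.val / q ^ r = j), proposers (f s) (A i)

/-- The memory after the numbers of proposals in subtrees of height `r` have been sent. -/
def upMem (r : ℕ) (j : Fin M) : List ℕ :=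
  A j ++ (List.finRange M).flatMap fun i =>
    if i.val / q = j then (List.range L).map fun s => tallyWord s (subtotal q f A r i s) else []

/-- The best seed for machine `j`. -/
noncomputable def bestSeed (j : Fin M) : ℕ :=
  best L fun s => tally s (upMem q L f A (k - 1) j)

/-- The ancestor `r` levels above machine `i`. -/
def ancestor (r : ℕ) (i : Fin M) : Fin M :=
  ⟨i.val / q ^ r, (Nat.div_le_self _ _).trans_lt i.2⟩

/-- The memory after the seeds have been sent `r` levels downwards. -/
noncomputable def downMem (r : ℕ) (i : Fin M) : List ℕ :=
  A i ++ [tallyWord (bestSeed q k L f A (ancestor q r i)) 0]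

/-- The memory after the proposals have been sent. -/
noncomputable def proposedMem (j : Fin M) : List ℕ :=
  (List.finRange M).flatMap fun i =>
    proposalsFor q (f (bestSeed q k L f A (ancestor q k i))) (A i) j

theorem subtotal_zero (j : Fin M) (s : ℕ) : subtotal q f A 0 j s = proposers (f s) (A j) := by
  have : Finset.univ.filter (fun i : Fin M => i.val / q ^ 0 = j) = {j} := by
    ext i; simp [Fin.ext_iff]
  rw [subtotal, this, Finset.sum_singleton]

/-- Because x / q^(r+1) = (x / q^r) / q, a subtree of height r + 1 is partitioned by the ancestors
at level r. The same machine indices serve as nodes at every level of the tree. -/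
theorem sum_subtotal (r : ℕ) (j : Fin M) (s : ℕ) :
    ∑ i ∈ Finset.univ.filter (fun i : Fin M => i.val / q = j), subtotal q f A r i s =
      subtotal q f A (r + 1) j s := by
  have hdiv : ∀ x : ℕ, x / q ^ (r + 1) = x / q ^ r / q := fun x => by
    rw [pow_succ, Nat.div_div_eq_div_mul]
  rw [subtotal, ← Finset.sum_fiberwise_of_maps_to
    (s := Finset.univ.filter (fun i : Fin M => i.val / q ^ (r + 1) = j)) (g := ancestor q r)
    (t := Finset.univ.filter (fun i : Fin M => i.val / q = j))]
  · refine Finset.sum_congr rfl fun i hi => ?_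
    rw [subtotal, Finset.filter_filter]
    refine Finset.sum_congr ?_ fun _ _ => rfl
    ext x
    simp only [Finset.mem_filter, Finset.mem_univ, true_and, ancestor, Fin.ext_iff] at hi ⊢
    constructor
    · intro h; exact ⟨by rw [hdiv, h, hi], h⟩
    · exact fun h => h.2
  · intro x hx
    simp only [Finset.mem_filter, Finset.mem_univ, true_and, ancestor] at hx ⊢
    rw [← hdiv, hx]

variable {A}

theorem tally_upMem (hA : ∀ j, ∀ w ∈ A j, w.unpair.1 = 0) (r : ℕ) (j : Fin M) {s : ℕ}
    (hs : s < L) : tally s (upMem q L f A r j) = subtotal q f A (r + 1) j s := by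
  rw [upMem, tally_append, tally_of_arcs s (hA j), zero_add, tally_flatMap, ← sum_subtotal,
    Finset.sum_filter]
  refine Finset.sum_congr rfl fun i _ => ?_
  split_ifs
  · exact tally_range hs fun s' => subtotal q f A r i s'
  · rfl

theorem filter_upMem (hA : ∀ j, ∀ w ∈ A j, w.unpair.1 = 0) (r : ℕ) (j : Fin M) :
    ((upMem q L f A r j).filter fun w => decide (w.unpair.1 = 0)) = A j := by
  refine filter_append_of_arcs (hA j) fun w hw => ?_
  obtain ⟨i, _, hw⟩ := List.mem_flatMap.1 hw
  split_ifs at hw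
  · obtain ⟨s, _, rfl⟩ := List.mem_map.1 hw
    simp [tallyWord]
  · simp at hw

theorem filter_downMem (hA : ∀ j, ∀ w ∈ A j, w.unpair.1 = 0) (r : ℕ) (j : Fin M) :
    ((downMem q k L f A r j).filter fun w => decide (w.unpair.1 = 0)) = A j := by
  refine filter_append_of_arcs (hA j) fun w hw => ?_
  simp only [List.mem_singleton] at hw
  simp [hw, tallyWord]

theorem run_one (input : Fin M → List (Fin n × Fin n)) :
    (program M q k L f).run (fun i => encodeEdges (input i)) 1 =
      fun j : Fin M => (List.finRange M).flatMap fun i => (input i).flatMap (arcsFor q j) := by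
  funext j
  simp [MPCProgram.run, MPCProgram.round, program, decodeEdges_encodeEdges]

theorem run_up (hA : ∀ j, ∀ w ∈ A j, w.unpair.1 = 0) {init : Fin M → List ℕ}
    (h1 : (program M q k L f).run init 1 = A) {r : ℕ} (hr : r < k) :
    (program M q k L f).run init (r + 2) = upMem q L f A r := by
  induction r with
  | zero =>
    funext j
    change (program M q k L f).round 1 ((program M q k L f).run init 1) j = _
    rw [h1, MPCProgram.round, upMem]
    congr 1
    · simp only [program, one_ne_zero, if_false, if_pos (show 1 ≤ 2 * k by omega)]
      rw [List.filter_eq_self]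
      intro w hw; simpa using hA j w hw
    · simp only [program, one_ne_zero, if_false, if_true, if_pos (show 1 ≤ k by omega),
        subtotal_zero]
  | succ r ih =>
    funext j
    change (program M q k L f).round (r + 2) ((program M q k L f).run init (r + 2)) j = _
    rw [ih (by omega), MPCProgram.round, upMem]
    congr 1
    · simp only [program, if_neg (show r + 2 ≠ 0 by omega), if_pos (show r + 2 ≤ 2 * k by omega)]
      exact filter_upMem q L f hA r j
    · simp only [program, if_neg (show r + 2 ≠ 0 by omega), if_pos (show r + 2 ≤ k by omega),
        if_neg (show r + 2 ≠ 1 by omega)]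
      congr 1
      funext i
      split_ifs
      · refine List.map_congr_left fun s hs => ?_
        rw [tally_upMem q L f hA r i (List.mem_range.1 hs)]
      · rfl

/-- In round k + 1 every machine, not only the root, announces a seed that is best for its own
tallies. Each round discards the old announcement in favour of the parent's, so r + 1 steps leave
the choice of the ancestor r + 1 levels up. -/
theorem run_down (hk : 0 < k) (hA : ∀ j, ∀ w ∈ A j, w.unpair.1 = 0) {init : Fin M → List ℕ}
    (h1 : (program M q k L f).run init 1 = A) {r : ℕ} (hr : r < k) :
    (program M q k L f).run init (k + r + 2) = downMem q k L f A (r + 1) := by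
  induction r with
  | zero =>
    funext j
    change (program M q k L f).round (k + 1) ((program M q k L f).run init (k + 1)) j = _
    have h2 := run_up q k L f hA h1 (show k - 1 < k by omega)
    rw [show k - 1 + 2 = k + 1 by omega] at h2
    rw [h2, MPCProgram.round, downMem]
    congr 1
    · simp only [program, if_neg (show k + 1 ≠ 0 by omega), if_pos (show k + 1 ≤ 2 * k by omega)]
      exact filter_upMem q L f hA _ j
    · simp only [program, if_neg (show k + 1 ≠ 0 by omega), if_pos (show k + 1 ≤ 2 * k by omega),
        if_neg (show ¬ k + 1 ≤ k by omega), if_true]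
      rw [flatMap_finRange_ite_eq _ ((Nat.div_le_self _ _).trans_lt j.2)]
      simp [bestSeed, ancestor]
  | succ r ih =>
    funext j
    change (program M q k L f).round (k + r + 2) ((program M q k L f).run init (k + r + 2)) j = _
    rw [ih (by omega), MPCProgram.round, downMem]
    congr 1
    · simp only [program, if_neg (show k + r + 2 ≠ 0 by omega),
        if_pos (show k + r + 2 ≤ 2 * k by omega)]
      exact filter_downMem q k L f hA _ j
    · simp only [program, if_neg (show k + r + 2 ≠ 0 by omega),
        if_pos (show k + r + 2 ≤ 2 * k by omega), if_neg (show ¬ k + r + 2 ≤ k by omega),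
        if_neg (show k + r + 2 ≠ k + 1 by omega)]
      rw [flatMap_finRange_ite_eq _ ((Nat.div_le_self _ _).trans_lt j.2), downMem,
        announced_append_tallyWord (hA _)]
      simp [ancestor, Nat.div_div_eq_div_mul, pow_succ']

theorem send_proposals (hA : ∀ j, ∀ w ∈ A j, w.unpair.1 = 0) (i j : Fin M) :
    (program M q k L f).send (2 * k + 1) i (downMem q k L f A k i) j =
      proposalsFor q (f (bestSeed q k L f A (ancestor q k i))) (A i) j := by
  simp only [program, if_neg (show 2 * k + 1 ≠ 0 by omega), if_neg (show ¬ 2 * k + 1 ≤ k by omega),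
    if_neg (show ¬ 2 * k + 1 ≤ 2 * k by omega), if_true]
  rw [downMem, announced_append_tallyWord (hA _)]
  simp only [proposalsFor, proposal_append_tallyWord]

theorem run_proposed (hk : 0 < k) (hA : ∀ j, ∀ w ∈ A j, w.unpair.1 = 0) {init : Fin M → List ℕ}
    (h1 : (program M q k L f).run init 1 = A) :
    (program M q k L f).run init (2 * k + 2) = proposedMem q k L f A := by
  funext j
  change (program M q k L f).round (2 * k + 1) ((program M q k L f).run init (2 * k + 1)) j = _
  have h2 := run_down q k L f hk hA h1 (show k - 1 < k by omega)
  rw [show k + (k - 1) + 2 = 2 * k + 1 by omega, show k - 1 + 1 = k by omega] at h2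
  rw [h2, MPCProgram.round, proposedMem]
  simp only [send_proposals q k L f hA]
  simp [program]

theorem run_accepted (hk : 0 < k) (hA : ∀ j, ∀ w ∈ A j, w.unpair.1 = 0) {init : Fin M → List ℕ}
    (h1 : (program M q k L f).run init 1 = A) :
    (program M q k L f).run init (2 * k + 3) =
      fun j => encodeEdges (accepted n (proposedMem q k L f A j)) := by
  funext j
  change (program M q k L f).round (2 * k + 2) ((program M q k L f).run init (2 * k + 2)) j = _
  rw [run_proposed q k L f hk hA h1, MPCProgram.round]
  simp [program, show ¬ 2 * k + 2 ≤ k by omega]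

end Run

/-! ### Bounds on ownership and communication. -/

section Counting

variable {n : ℕ}

theorem card_owned_le {q : ℕ} (hq : 0 < q) (j : ℕ) :
    (Finset.univ.filter fun u : Fin n => owner q u = j).card ≤ q ^ 2 := by
  refine (Finset.card_le_card_of_injOn (t := Finset.range (q ^ 2)) (fun u => u.val % q ^ 2)
    ?_ ?_).trans (Finset.card_range _).le
  · intro u _
    simpa using Nat.mod_lt _ (pow_pos hq 2)
  · intro u hu v hv h
    simp only [Finset.coe_filter, Finset.mem_univ, true_and, Set.mem_ofPred_eq] at hu hv h
    rw [owner] at hu hv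
    apply Fin.ext
    rw [← Nat.div_add_mod u.val (q ^ 2), ← Nat.div_add_mod v.val (q ^ 2), hu, hv, h]

theorem card_fin_div_eq_le {M q : ℕ} (hq : 0 < q) (j : ℕ) :
    (Finset.univ.filter fun i : Fin M => i.val / q = j).card ≤ q := by
  refine (Finset.card_le_card_of_injOn (t := Finset.range q) (fun u => u.val % q)
    ?_ ?_).trans (Finset.card_range _).le
  · intro u _
    simpa using Nat.mod_lt _ hq
  · intro u hu v hv h
    simp only [Finset.coe_filter, Finset.mem_univ, true_and, Set.mem_ofPred_eq] at hu hv h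
    apply Fin.ext
    rw [← Nat.div_add_mod u.val q, ← Nat.div_add_mod v.val q, hu, hv, h]

theorem length_arcs_le {q : ℕ} (hq : 0 < q) (j : ℕ) (G : SimpleGraph (Fin n))
    [DecidableRel G.Adj] (hG : G.maxDegree ≤ 2) {l : List ℕ} (hl : l.Nodup)
    (h : ∀ w ∈ l, ∃ u v, G.Adj u v ∧ owner q u = j ∧ w = arcWord u v) :
    l.length ≤ 2 * q ^ 2 := by
  rw [← List.toFinset_card_of_nodup hl]
  have hsub : l.toFinset ⊆ (Finset.univ.filter fun u : Fin n => owner q u = j).biUnion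
      fun u => (G.neighborFinset u).image (arcWord u) := by
    intro w hw
    obtain ⟨u, v, huv, hu, rfl⟩ := h w (List.mem_toFinset.1 hw)
    simp only [Finset.mem_biUnion, Finset.mem_filter, Finset.mem_univ, true_and, Finset.mem_image]
    exact ⟨u, hu, v, by simpa using huv, rfl⟩
  refine (Finset.card_le_card hsub).trans (Finset.card_biUnion_le.trans ?_)
  refine (Finset.sum_le_card_nsmul _ _ 2 fun u _ => ?_).trans ?_
  · exact Finset.card_image_le.trans (((G.card_neighborFinset_eq_degree u).le.trans
      (G.degree_le_maxDegree u)).trans hG)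
  · rw [smul_eq_mul, mul_comm]
    exact Nat.mul_le_mul_left 2 (card_owned_le hq j)

theorem sum_length_arcsFor_le (q M : ℕ) (l : List (Fin n × Fin n)) :
    ∑ j : Fin M, (l.flatMap (arcsFor q j)).length ≤ 2 * l.length := by
  have hone : ∀ (a : ℕ) (w : ℕ), ∑ j : Fin M, (if a = j.val then [w] else []).length ≤ 1 := by
    intro a w
    have : ∀ j : Fin M, (if a = j.val then [w] else []).length = if a = j.val then 1 else 0 :=
      fun j => by split_ifs <;> rfl
    simp only [this]
    rw [← Finset.card_filter]
    refine Finset.card_le_one.2 fun x hx y hy => ?_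
    simp only [Finset.mem_filter, Finset.mem_univ, true_and] at hx hy
    exact Fin.ext (hx.symm.trans hy)
  induction l with
  | nil => simp
  | cons p l ih =>
    simp only [List.flatMap_cons, List.length_append, Finset.sum_add_distrib, arcsFor] at ih ⊢
    have h1 := hone (owner q p.1) (arcWord p.1 p.2)
    have h2 := hone (owner q p.2) (arcWord p.2 p.1)
    simp only [List.length_cons]
    omega

theorem sum_length_filterMap_le {α : Type*} (M : ℕ) (l : List α) (o : α → Option (Fin n))
    (t : Fin n → ℕ) (w : Fin n → α → ℕ) :
    ∑ j : Fin M, (l.filterMap fun u => (o u).bind fun v =>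
      if t v = j then some (w v u) else none).length ≤ (l.filter fun u => (o u).isSome).length := by
  induction l with
  | nil => simp
  | cons a l ih =>
    cases ho : o a with
    | none => simpa [ho] using ih
    | some v =>
      have hsplit : ∀ j : Fin M, ((a :: l).filterMap fun u => (o u).bind fun v =>
          if t v = j then some (w v u) else none).length =
          (if t v = j then 1 else 0) + (l.filterMap fun u => (o u).bind fun v =>
          if t v = j then some (w v u) else none).length := by
        intro j
        rw [List.filterMap_cons, ho]
        by_cases h : t v = j
        · simp [h, add_comm]
        · simp [h]
      simp only [hsplit, Finset.sum_add_distrib]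
      have h1 : ∑ j : Fin M, (if t v = j.val then 1 else 0) ≤ 1 := by
        rw [← Finset.card_filter]
        refine Finset.card_le_one.2 fun x hx y hy => ?_
        simp only [Finset.mem_filter, Finset.mem_univ, true_and] at hx hy
        exact Fin.ext (hx.symm.trans hy)
      simp only [ho, Option.isSome_some, List.filter_cons_of_pos, List.length_cons]
      omega

theorem sum_length_proposalsFor_le (q M : ℕ) (g : Fin n → Bool) (mem : List ℕ) :
    ∑ j : Fin M, (proposalsFor q g mem j).length ≤ proposers g mem := by
  refine (sum_length_filterMap_le M _ (proposal g mem) (owner q) arcWord).trans (le_of_eq ?_)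
  rw [proposers, ← List.toFinset_card_of_nodup ((List.nodup_finRange n).filter _)]
  congr 1
  ext u
  simp

end Counting

/-! ### From proposals to a matching, and averaging over the seeds. -/

section Matching

variable {n : ℕ} (G : SimpleGraph (Fin n)) [DecidableRel G.Adj]

/-- If vertices on one side of a bipartition propose to neighbors on the other side, which accept
one proposal each, then the result is a matching. -/
theorem exists_matching_of_proposals (hG : G.maxDegree ≤ 2) (g : Fin n → Bool)
    (p acc : Fin n → Option (Fin n))
    (hp : ∀ u v, p u = some v → G.Adj u v ∧ g u = true ∧ g v = false)
    (hacc : ∀ v u, acc v = some u → p u = some v)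
    (hsome : ∀ u v, p u = some v → (acc v).isSome) :
    ∃ N : G.Subgraph, N.IsMatching ∧ N.edgeSet = {e | ∃ v u, acc v = some u ∧ s(v, u) = e} ∧
      (Finset.univ.filter fun u => (p u).isSome).card ≤ 2 * N.edgeSet.ncard := by
  have hadj : ∀ v u, acc v = some u → G.Adj v u := fun v u h => (hp u v (hacc v u h)).1.symm
  let N : G.Subgraph :=
    { verts := {x | ∃ y, acc x = some y ∨ acc y = some x}
      Adj := fun x y => acc x = some y ∨ acc y = some x
      adj_sub := by
        rintro x y (h | h)
        · exact hadj x y h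
        · exact (hadj y x h).symm
      edge_vert := fun {x y} h => ⟨y, h⟩
      symm := ⟨fun x y h => h.symm⟩ }
  have hedge : N.edgeSet = {e | ∃ v u, acc v = some u ∧ s(v, u) = e} := by
    ext e
    induction e with
    | _ x y =>
      simp only [SimpleGraph.Subgraph.mem_edgeSet, Set.mem_ofPred_eq]
      constructor
      · rintro (h | h)
        · exact ⟨x, y, h, rfl⟩
        · exact ⟨y, x, h, Sym2.eq_swap⟩
      · rintro ⟨v, u, h, he⟩
        rcases Sym2.eq_iff.1 he with ⟨rfl, rfl⟩ | ⟨rfl, rfl⟩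
        · exact Or.inl h
        · exact Or.inr h
  refine ⟨N, ?_, hedge, ?_⟩
  · rintro x ⟨y, h⟩
    refine ⟨y, h, fun w hw => ?_⟩
    -- In the mixed cases `x` would both accept and propose, hence be coloured `false` and `true`.
    -- Otherwise it accepts, or proposes to, only one vertex.
    rcases h with h | h <;> rcases hw with hw | hw
    · exact Option.some_injective _ (hw.symm.trans h)
    · have h1 := (hp _ _ (hacc _ _ h)).2.2
      have h2 := (hp _ _ (hacc _ _ hw)).2.1
      simp [h1] at h2
    · have h1 := (hp _ _ (hacc _ _ h)).2.1
      have h2 := (hp _ _ (hacc _ _ hw)).2.2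
      simp [h1] at h2
    · exact Option.some_injective _ ((hacc _ _ hw).symm.trans (hacc _ _ h))
  -- Acceptors inject into the edges, as each edge has only one `false` endpoint. Proposers then map
  -- to acceptors with fibres inside neighbourhoods, of size at most 2.
  · have h1 : (Finset.univ.filter fun v => (acc v).isSome).card ≤ N.edgeSet.ncard := by
      rw [← Set.ncard_coe_finset]
      refine Set.ncard_le_ncard_of_injOn (fun v => s(v, (acc v).getD v)) ?_ ?_ (Set.toFinite _)
      · intro v hv
        simp only [Finset.coe_filter, Finset.mem_univ, true_and, Set.mem_ofPred_eq] at hv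
        obtain ⟨u, hu⟩ := Option.isSome_iff_exists.1 hv
        rw [hedge]
        exact ⟨v, u, hu, by simp [hu]⟩
      · intro v hv v' hv' h
        simp only [Finset.coe_filter, Finset.mem_univ, true_and, Set.mem_ofPred_eq] at hv hv'
        obtain ⟨u, hu⟩ := Option.isSome_iff_exists.1 hv
        obtain ⟨u', hu'⟩ := Option.isSome_iff_exists.1 hv'
        simp only [hu, hu', Option.getD_some] at h
        rcases Sym2.eq_iff.1 h with ⟨h, -⟩ | ⟨rfl, rfl⟩
        · exact h
        · have h1 := (hp _ _ (hacc _ _ hu)).2.1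
          have h2 := (hp _ _ (hacc _ _ hu')).2.2
          simp [h1] at h2
    refine le_trans ?_ (Nat.mul_le_mul_left 2 h1)
    refine Finset.card_le_mul_card_image_of_maps_to (f := fun u => (p u).getD u) ?_ 2 ?_
    · intro u hu
      simp only [Finset.mem_filter, Finset.mem_univ, true_and] at hu ⊢
      obtain ⟨v, hv⟩ := Option.isSome_iff_exists.1 hu
      rw [hv]
      exact hsome u v hv
    · intro v _
      refine le_trans (Finset.card_le_card ?_) (((G.card_neighborFinset_eq_degree v).le.trans
        (G.degree_le_maxDegree v)).trans hG)
      intro u hu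
      simp only [Finset.mem_filter, Finset.mem_univ, true_and] at hu
      obtain ⟨w, hw⟩ := Option.isSome_iff_exists.1 hu.1
      have : w = v := by simpa [hw] using hu.2
      subst this
      simpa using (hp u w hw).1.symm

/-- The number of vertices with `g = true` that have a neighbor with `g = false`. -/
def crossing (g : Fin n → Bool) : ℕ :=
  (Finset.univ.filter fun u => g u = true ∧ ∃ v, G.Adj u v ∧ g v = false).card

variable {G} in
-- The family property is applied to `u` and its neighbours: the one neighbour taken twice in degree
-- 1, both in degree 2.
theorem degree_mul_le_card_seeds (hG : G.maxDegree ≤ 2) {h : ℕ} {f : ℕ → Fin n → Bool}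
    (hf : ∀ u v w : Fin n, v ≠ u → w ≠ u →
      (if v = w then h else 2 * h) ≤ ((Finset.range (8 * h)).filter fun s =>
        f s u = true ∧ (f s v = false ∨ f s w = false)).card) (u : Fin n) :
    G.degree u * h ≤ ((Finset.range (8 * h)).filter fun s =>
      f s u = true ∧ ∃ v, G.Adj u v ∧ f s v = false).card := by
  have key : ∀ v w, G.Adj u v → G.Adj u w → (if v = w then h else 2 * h) ≤
      ((Finset.range (8 * h)).filter fun s =>
        f s u = true ∧ ∃ v, G.Adj u v ∧ f s v = false).card := by
    intro v w hv hw
    refine (hf u v w hv.ne' hw.ne').trans (Finset.card_le_card ?_)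
    intro s hs
    simp only [Finset.mem_filter] at hs ⊢
    refine ⟨hs.1, hs.2.1, ?_⟩
    rcases hs.2.2 with h | h
    · exact ⟨v, hv, h⟩
    · exact ⟨w, hw, h⟩
  have hd := (G.degree_le_maxDegree u).trans hG
  have hmem : ∀ v, v ∈ G.neighborFinset u → G.Adj u v := fun v => (G.mem_neighborFinset u v).1
  rw [← G.card_neighborFinset_eq_degree] at hd ⊢
  generalize G.neighborFinset u = X at hd hmem ⊢
  interval_cases hX : X.card
  · simp
  · obtain ⟨v, rfl⟩ := Finset.card_eq_one.1 hX
    have hv := hmem v (by simp)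
    simpa using key v v hv hv
  · obtain ⟨v, w, hvw, rfl⟩ := Finset.card_eq_two.1 hX
    simpa [hvw] using key v w (hmem v (by simp)) (hmem w (by simp))

variable {G} in
-- Double counting of pairs of a seed and a vertex that proposes for it: 2m · h ≤ 8h · b.
theorem card_edgeFinset_le_crossing (hG : G.maxDegree ≤ 2) {h : ℕ} (hh : 0 < h)
    {f : ℕ → Fin n → Bool}
    (hf : ∀ u v w : Fin n, v ≠ u → w ≠ u →
      (if v = w then h else 2 * h) ≤ ((Finset.range (8 * h)).filter fun s =>
        f s u = true ∧ (f s v = false ∨ f s w = false)).card) {b : ℕ}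
    (hb : ∀ s < 8 * h, crossing G (f s) ≤ b) :
    G.edgeFinset.card ≤ 4 * b := by
  have h1 : ∑ u, G.degree u * h ≤ ∑ s ∈ Finset.range (8 * h), crossing G (f s) := by
    simp only [crossing, Finset.card_filter]
    rw [Finset.sum_comm]
    refine Finset.sum_le_sum fun u _ => ?_
    rw [← Finset.card_filter]
    exact degree_mul_le_card_seeds hG hf u
  have h2 : ∑ s ∈ Finset.range (8 * h), crossing G (f s) ≤ 8 * h * b := by
    refine (Finset.sum_le_card_nsmul _ _ b fun s hs => hb s (Finset.mem_range.1 hs)).trans ?_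
    simp
  rw [← Finset.sum_mul, G.sum_degrees_eq_twice_card_edges] at h1
  have h3 : (2 * h) * G.edgeFinset.card ≤ (2 * h) * (4 * b) := by linarith
  exact Nat.le_of_mul_le_mul_left h3 (by omega)

end Matching

/-! ### Arcs, proposals and acceptances held by the machines. -/

section Proposals

variable {n M q : ℕ} (G : SimpleGraph (Fin n)) {S : ℕ} {input : Fin M → List (Fin n × Fin n)}

/-- The arcs on machine `j` after the first round. -/
def gathered (q : ℕ) (input : Fin M → List (Fin n × Fin n)) (j : Fin M) : List ℕ :=
  (List.finRange M).flatMap fun i => (input i).flatMap (arcsFor q j)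

variable {G}

/-- After the first round the set of stored arcs no longer depends on how the input was distributed.
-/
theorem mem_gathered (hin : IsEdgeDistribution G S input) (j : Fin M) (w : ℕ) :
    w ∈ gathered q input j ↔ ∃ u v, G.Adj u v ∧ owner q u = j ∧ w = arcWord u v := by
  simp only [gathered, List.mem_flatMap, List.mem_finRange, true_and, arcsFor, List.mem_append]
  constructor
  · rintro ⟨i, p, hp, h⟩
    have hadj : G.Adj p.1 p.2 := by
      rw [← SimpleGraph.mem_edgeSet, ← hin.1]
      exact ⟨i, p, hp, rfl⟩
    rcases h with h | h <;> split_ifs at h with h1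
    · exact ⟨p.1, p.2, hadj, h1, List.mem_singleton.1 h⟩
    · simp at h
    · exact ⟨p.2, p.1, hadj.symm, h1, List.mem_singleton.1 h⟩
    · simp at h
  · rintro ⟨u, v, huv, hu, rfl⟩
    rw [← SimpleGraph.mem_edgeSet, ← hin.1] at huv
    obtain ⟨i, p, hp, he⟩ := huv
    refine ⟨i, p, hp, ?_⟩
    rcases Sym2.eq_iff.1 he with ⟨rfl, rfl⟩ | ⟨rfl, rfl⟩
    · left; simp [hu]
    · right; simp [hu]

/-- An arc determines its undirected edge, which is listed once, and the two arcs of an edge differ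
because there are no loops. This makes list lengths countable by degrees. -/
theorem nodup_gathered (hin : IsEdgeDistribution G S input) (j : Fin M) :
    (gathered q input j).Nodup := by
  have h1 := hin.2.1
  rw [← List.map_flatMap] at h1
  rw [gathered, ← List.flatMap_assoc]
  have hne : ∀ p ∈ (List.finRange M).flatMap input, p.1 ≠ p.2 := by
    intro p hp
    obtain ⟨i, _, hp⟩ := List.mem_flatMap.1 hp
    have hadj : G.Adj p.1 p.2 := by
      rw [← SimpleGraph.mem_edgeSet, ← hin.1]
      exact ⟨i, p, hp, rfl⟩
    exact hadj.ne
  have hmem : ∀ (p : Fin n × Fin n) (w : ℕ), w ∈ arcsFor q j p →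
      ∃ u v, s(p.1, p.2) = s(u, v) ∧ w = arcWord u v := by
    intro p w hw
    rcases List.mem_append.1 hw with h | h <;> split_ifs at h
    · exact ⟨p.1, p.2, rfl, List.mem_singleton.1 h⟩
    · simp at h
    · exact ⟨p.2, p.1, Sym2.eq_swap, List.mem_singleton.1 h⟩
    · simp at h
  rw [List.nodup_flatMap]
  constructor
  · intro p hp
    have := hne p hp
    rw [arcsFor]
    split_ifs <;> simp [arcWord_inj, this]
  · refine (List.pairwise_map.1 h1).imp fun {p p'} hpp => ?_
    intro w hw hw'
    obtain ⟨u, v, he, rfl⟩ := hmem p w hw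
    obtain ⟨u', v', he', h⟩ := hmem p' _ hw'
    obtain ⟨rfl, rfl⟩ := arcWord_inj.1 h
    exact hpp (he.trans he'.symm)

theorem proposal_eq_some (hin : IsEdgeDistribution G S input) {g : Fin n → Bool} {i : Fin M}
    {u v : Fin n} (h : proposal g (gathered q input i) u = some v) :
    G.Adj u v ∧ owner q u = i ∧ g u = true ∧ g v = false := by
  have h1 := List.find?_some h
  simp only [Bool.and_eq_true, Bool.not_eq_true', decide_eq_true_eq, mem_gathered hin] at h1
  obtain ⟨⟨hu, hv⟩, u', v', hadj, hown, he⟩ := h1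
  obtain ⟨rfl, rfl⟩ := arcWord_inj.1 he
  exact ⟨hadj, hown, hu, hv⟩

theorem isSome_proposal_iff (hin : IsEdgeDistribution G S input) (g : Fin n → Bool) (i : Fin M)
    (u : Fin n) : (proposal g (gathered q input i) u).isSome ↔
      owner q u = i ∧ g u = true ∧ ∃ v, G.Adj u v ∧ g v = false := by
  constructor
  · intro h
    obtain ⟨v, hv⟩ := Option.isSome_iff_exists.1 h
    obtain ⟨h1, h2, h3, h4⟩ := proposal_eq_some hin hv
    exact ⟨h2, h3, v, h1, h4⟩
  · rintro ⟨h1, h2, v, h3, h4⟩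
    rw [proposal, List.find?_isSome]
    refine ⟨v, List.mem_finRange v, ?_⟩
    simp only [h2, h4, Bool.not_false, Bool.and_self, Bool.true_and, decide_eq_true_eq,
      mem_gathered hin]
    exact ⟨u, v, h3, h1, rfl⟩

theorem proposers_le (hin : IsEdgeDistribution G S input) (hq : 0 < q) (g : Fin n → Bool)
    (i : Fin M) : proposers g (gathered q input i) ≤ q ^ 2 := by
  refine (Finset.card_le_card ?_).trans (card_owned_le (n := n) hq i)
  intro u hu
  simp only [Finset.mem_filter, Finset.mem_univ, true_and] at hu ⊢
  exact ((isSome_proposal_iff hin g i u).1 hu).1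

theorem sum_proposers [DecidableRel G.Adj] (hin : IsEdgeDistribution G S input)
    (hM : ∀ v : Fin n, owner q v < M) (g : Fin n → Bool) :
    ∑ i, proposers g (gathered q input i) = crossing G g := by
  rw [crossing, Finset.card_eq_sum_card_fiberwise (f := fun u => (⟨owner q u, hM u⟩ : Fin M))
    (t := Finset.univ) (by intro _ _; simp)]
  refine Finset.sum_congr rfl fun i _ => ?_
  rw [proposers, Finset.filter_filter]
  congr 1
  ext u
  simp only [Finset.mem_filter, Finset.mem_univ, true_and, isSome_proposal_iff hin, Fin.ext_iff]
  tauto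

theorem crossing_le [DecidableRel G.Adj] (g : Fin n → Bool) : crossing G g ≤ n :=
  (Finset.card_le_univ _).trans (Fintype.card_fin n).le

theorem mem_proposalsFor (g : Fin n → Bool) (mem : List ℕ) (j w : ℕ) :
    w ∈ proposalsFor q g mem j ↔
      ∃ u v, proposal g mem u = some v ∧ owner q v = j ∧ w = arcWord v u := by
  simp only [proposalsFor, List.mem_filterMap, List.mem_finRange, true_and,
    Option.bind_eq_some_iff, Option.ite_none_right_eq_some, Option.some.injEq]
  constructor
  · rintro ⟨u, v, h1, h2, h3⟩; exact ⟨u, v, h1, h2, h3.symm⟩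
  · rintro ⟨u, v, h1, h2, h3⟩; exact ⟨u, v, h1, h2, h3.symm⟩

/-- A proposal word names its proposer, which has a single owner and proposes at most once. -/
theorem nodup_proposals (hin : IsEdgeDistribution G S input) (g : Fin n → Bool) (j : ℕ) :
    ((List.finRange M).flatMap fun i => proposalsFor q g (gathered q input i) j).Nodup := by
  rw [List.nodup_flatMap]
  constructor
  · intro i _
    refine (List.nodup_finRange n).filterMap ?_
    intro u u' w hw hw'
    simp only [Option.mem_def, Option.bind_eq_some_iff, Option.ite_none_right_eq_some,
      Option.some.injEq] at hw hw'
    obtain ⟨v, -, -, rfl⟩ := hw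
    obtain ⟨v', -, -, h⟩ := hw'
    exact (arcWord_inj.1 h).2.symm
  · refine (List.nodup_finRange M).imp fun {i i'} hne w hw hw' => hne ?_
    obtain ⟨u, v, h, -, rfl⟩ := (mem_proposalsFor _ _ _ _).1 hw
    obtain ⟨u', v', h', -, he⟩ := (mem_proposalsFor _ _ _ _).1 hw'
    obtain ⟨rfl, rfl⟩ := arcWord_inj.1 he
    exact Fin.ext ((proposal_eq_some hin h).2.1.symm.trans (proposal_eq_some hin h').2.1)

theorem mem_accepted (mem : List ℕ) (v u : Fin n) : (v, u) ∈ accepted n mem ↔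
    (List.finRange n).find? (fun u => decide (arcWord v u ∈ mem)) = some u := by
  simp only [accepted, List.mem_filterMap, List.mem_finRange, true_and, Option.map_eq_some_iff,
    Prod.mk.injEq]
  constructor
  · rintro ⟨_, _, h, rfl, rfl⟩; exact h
  · intro h; exact ⟨v, u, h, rfl, rfl⟩

theorem length_accepted_le (hq : 0 < q) {j : ℕ} {mem : List ℕ}
    (h : ∀ v u : Fin n, arcWord v u ∈ mem → owner q v = j) :
    (accepted n mem).length ≤ q ^ 2 := by
  have hnd : ((accepted n mem).map Prod.fst).Nodup := by
    rw [accepted, List.map_filterMap]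
    refine (List.nodup_finRange n).filterMap ?_
    intro u u' w hw hw'
    simp only [Option.mem_def, Option.map_map, Option.map_eq_some_iff, Function.comp] at hw hw'
    obtain ⟨_, _, rfl⟩ := hw
    obtain ⟨_, _, h⟩ := hw'
    exact h.symm
  rw [← List.length_map (f := Prod.fst), ← List.toFinset_card_of_nodup hnd]
  refine (Finset.card_le_card ?_).trans (card_owned_le (n := n) hq j)
  intro v hv
  rw [List.mem_toFinset, List.mem_map] at hv
  obtain ⟨⟨v, u⟩, hv, rfl⟩ := hv
  have := List.find?_some ((mem_accepted _ _ _).1 hv)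
  simpa using h v u (by simpa using this)

end Proposals

/-! ### Correctness, space and communication of the whole run. -/

section Final

variable {n M q k L S B : ℕ} {G : SimpleGraph (Fin n)}
  {input : Fin M → List (Fin n × Fin n)} (f : ℕ → Fin n → Bool)

theorem length_flatMap_finRange {α : Type*} (l : Fin M → List α) :
    ((List.finRange M).flatMap l).length = ∑ i, (l i).length := by
  rw [List.length_flatMap, Fin.sum_univ_def]

theorem unpair_of_mem_gathered (hin : IsEdgeDistribution G S input) :
    ∀ j, ∀ w ∈ gathered q input j, w.unpair.1 = 0 := by
  intro j w hw
  obtain ⟨u, v, -, -, rfl⟩ := (mem_gathered hin j w).1 hw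
  simp

theorem bestSeed_lt (hL : 0 < L) (A : Fin M → List ℕ) (j : Fin M) : bestSeed q k L f A j < L :=
  (best_spec hL _).1

/-- After k levels everyone's ancestor is machine 0, so all machines end up with the same seed. -/
theorem ancestor_eq (hMk : M ≤ q ^ k) (i j : Fin M) : ancestor q k i = ancestor q k j := by
  simp [ancestor, Nat.div_eq_of_lt (i.2.trans_le hMk), Nat.div_eq_of_lt (j.2.trans_le hMk)]

theorem proposedMem_eq (hMk : M ≤ q ^ k) (A : Fin M → List ℕ) (i₀ j : Fin M) :
    proposedMem q k L f A j = (List.finRange M).flatMap fun i =>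
      proposalsFor q (f (bestSeed q k L f A (ancestor q k i₀))) (A i) j := by
  simp only [proposedMem, ancestor_eq hMk _ i₀]

theorem mem_proposedMem (hMk : M ≤ q ^ k) {i₀ j : Fin M} {w : ℕ} :
    w ∈ proposedMem q k L f (gathered q input) j ↔
      ∃ i u v, proposal (f (bestSeed q k L f (gathered q input) (ancestor q k i₀)))
        (gathered q input i) u = some v ∧ owner q v = j ∧ w = arcWord v u := by
  rw [proposedMem_eq f hMk _ i₀]
  simp only [List.mem_flatMap, List.mem_finRange, true_and, mem_proposalsFor]

theorem mem_proposedMem_adj (hin : IsEdgeDistribution G S input) (hMk : M ≤ q ^ k) {j : Fin M}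
    {w : ℕ} (hw : w ∈ proposedMem q k L f (gathered q input) j) :
    ∃ v u, G.Adj v u ∧ owner q v = j ∧ w = arcWord v u := by
  obtain ⟨i, u, v, h, hv, rfl⟩ := (mem_proposedMem f hMk (i₀ := j)).1 hw
  exact ⟨v, u, (proposal_eq_some hin h).1.symm, hv, rfl⟩

theorem length_accepted_proposedMem_le (hin : IsEdgeDistribution G S input)
    (hq : 0 < q) (hMk : M ≤ q ^ k) (j : Fin M) :
    (accepted n (proposedMem q k L f (gathered q input) j)).length ≤ q ^ 2 := by
  refine length_accepted_le (j := j) hq fun v u h => ?_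
  obtain ⟨v', u', -, hv, he⟩ := mem_proposedMem_adj f hin hMk h
  obtain ⟨rfl, rfl⟩ := arcWord_inj.1 he
  exact hv

variable [DecidableRel G.Adj]

theorem subtotal_le (hin : IsEdgeDistribution G S input) (hM : ∀ v : Fin n, owner q v < M)
    (r : ℕ) (j : Fin M) (s : ℕ) : subtotal q f (gathered q input) r j s ≤ n := by
  refine le_trans ?_ (crossing_le (G := G) (f s))
  rw [← sum_proposers hin hM]
  exact Finset.sum_le_sum_of_subset (Finset.filter_subset _ _)

theorem length_gathered_le (hin : IsEdgeDistribution G S input) (hG : G.maxDegree ≤ 2)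
    (hq : 0 < q) (j : Fin M) : (gathered q input j).length ≤ 2 * q ^ 2 :=
  length_arcs_le hq j G hG (nodup_gathered hin j) fun w hw => (mem_gathered hin j w).1 hw

theorem length_upMem_le (hin : IsEdgeDistribution G S input) (hG : G.maxDegree ≤ 2)
    (hq : 0 < q) (r : ℕ) (j : Fin M) :
    (upMem q L f (gathered q input) r j).length ≤ 2 * q ^ 2 + q * L := by
  rw [upMem, List.length_append, length_flatMap_finRange]
  refine Nat.add_le_add (length_gathered_le hin hG hq j) ?_
  have : ∀ i : Fin M, (if i.val / q = j.val then (List.range L).map fun s =>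
      tallyWord s (subtotal q f (gathered q input) r i s) else []).length =
      if i.val / q = j then L else 0 := by
    intro i; split_ifs <;> simp
  simp only [this]
  rw [← Finset.sum_filter, Finset.sum_const, smul_eq_mul]
  exact Nat.mul_le_mul_right L (card_fin_div_eq_le hq j)

theorem length_proposedMem_le (hin : IsEdgeDistribution G S input) (hG : G.maxDegree ≤ 2)
    (hq : 0 < q) (hMk : M ≤ q ^ k) (j : Fin M) :
    (proposedMem q k L f (gathered q input) j).length ≤ 2 * q ^ 2 := by
  refine length_arcs_le hq j G hG ?_ fun w hw => mem_proposedMem_adj f hin hMk hw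
  rw [proposedMem_eq f hMk _ j]
  exact nodup_proposals hin _ _

theorem lt_of_mem_encodeEdges {l : List (Fin n × Fin n)} {w : ℕ} (hw : w ∈ encodeEdges l) :
    w < n := by
  simp only [encodeEdges, List.mem_flatMap, List.mem_cons, List.not_mem_nil, or_false] at hw
  obtain ⟨p, -, rfl | rfl⟩ := hw
  · exact p.1.2
  · exact p.2.2

theorem runsWithin_program (hin : IsEdgeDistribution G S input) (hG : G.maxDegree ≤ 2)
    (hq : 0 < q) (hk : 0 < k) (hL : 0 < L) (hM : ∀ v : Fin n, owner q v < M) (hMk : M ≤ q ^ k)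
    (hS : 2 * q ^ 2 + q * L ≤ S) (hn : n ≤ B) (hB : ∀ u v : Fin n, arcWord u v < B)
    (hB' : ∀ s < L, ∀ c ≤ n, tallyWord s c < B) :
    (program M q k L f).RunsWithin S B (2 * k + 3) fun i => encodeEdges (input i) := by
  have hA := unpair_of_mem_gathered (q := q) hin
  have h1 : (program M q k L f).run (fun i => encodeEdges (input i)) 1 = gathered q input :=
    run_one q k L f input
  have hup := fun r => run_up q k L f hA h1 (r := r)
  have hdown := fun r => run_down q k L f hk hA h1 (r := r)
  have hpos : 0 < q * L := Nat.mul_pos hq hL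
  have hLS : L ≤ S := by
    have : L ≤ q * L := Nat.le_mul_of_pos_left L hq
    omega
  have hqS : q ≤ S := by
    have : q ≤ q * L := Nat.le_mul_of_pos_right q hL
    omega
  have hgB : ∀ i, ∀ w ∈ gathered q input i, w < B := by
    intro i w hw
    obtain ⟨u, v, -, -, rfl⟩ := (mem_gathered hin i w).1 hw
    exact hB u v
  constructor
  · intro t ht i
    -- Input, gathered arcs, summation, broadcast, proposals, output; the summation phase has the
    -- largest memory bound.
    obtain rfl | rfl | ⟨r, hr, rfl⟩ | ⟨r, hr, rfl⟩ | rfl | rfl : t = 0 ∨ t = 1 ∨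
        (∃ r < k, t = r + 2) ∨ (∃ r < k, t = k + r + 2) ∨ t = 2 * k + 2 ∨ t = 2 * k + 3 := by
      by_cases ht1 : t ≤ 1
      · omega
      by_cases ht2 : t < k + 2
      · exact Or.inr (Or.inr (Or.inl ⟨t - 2, by omega, by omega⟩))
      by_cases ht3 : t < 2 * k + 2
      · exact Or.inr (Or.inr (Or.inr (Or.inl ⟨t - k - 2, by omega, by omega⟩)))
      · omega
    · exact ⟨hin.2.2 i, fun w hw => (lt_of_mem_encodeEdges hw).trans_le hn⟩
    · rw [h1]
      exact ⟨(length_gathered_le hin hG hq i).trans (by omega), hgB i⟩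
    · rw [hup r hr]
      refine ⟨(length_upMem_le f hin hG hq r i).trans hS, fun w hw => ?_⟩
      rcases List.mem_append.1 hw with hw | hw
      · exact hgB i w hw
      · obtain ⟨i', _, hw⟩ := List.mem_flatMap.1 hw
        split_ifs at hw
        · obtain ⟨s, hs, rfl⟩ := List.mem_map.1 hw
          exact hB' s (List.mem_range.1 hs) _ (subtotal_le f hin hM r i' s)
        · simp at hw
    · rw [hdown r hr, downMem]
      refine ⟨?_, fun w hw => ?_⟩
      · have := length_gathered_le hin hG hq i
        rw [List.length_append, List.length_singleton]
        omega
      · rcases List.mem_append.1 hw with hw | hw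
        · exact hgB i w hw
        · rw [List.mem_singleton.1 hw]
          exact hB' _ (bestSeed_lt f hL _ _) _ (Nat.zero_le n)
    · rw [run_proposed q k L f hk hA h1]
      refine ⟨(length_proposedMem_le f hin hG hq hMk i).trans (by omega), fun w hw => ?_⟩
      obtain ⟨v, u, -, -, rfl⟩ := mem_proposedMem_adj f hin hMk hw
      exact hB v u
    · rw [run_accepted q k L f hk hA h1]
      refine ⟨?_, fun w hw => (lt_of_mem_encodeEdges hw).trans_le hn⟩
      have := length_accepted_proposedMem_le (L := L) f hin hq hMk i
      rw [length_encodeEdges]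
      omega
  · intro t ht i
    by_cases ht0 : t = 0
    · subst ht0
      simp only [program, if_true, MPCProgram.run, decodeEdges_encodeEdges]
      refine (sum_length_arcsFor_le q M (input i)).trans ?_
      rw [← length_encodeEdges]
      exact hin.2.2 i
    by_cases ht1 : t ≤ k
    · simp only [program, if_neg ht0, if_pos ht1]
      refine le_trans (Finset.sum_le_sum (g := fun j : Fin M => if j.val = i.val / q then L else 0)
        fun j _ => ?_) (le_trans ?_ hLS)
      · by_cases h : i.val / q = j.val
        · simp [h]
        · simp [h]
      · rw [← Finset.sum_filter, Finset.sum_const, smul_eq_mul]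
        refine le_trans (Nat.mul_le_mul_right L (?_ : _ ≤ 1)) (one_mul L).le
        refine Finset.card_le_one.2 fun x hx y hy => ?_
        simp only [Finset.mem_filter, Finset.mem_univ, true_and] at hx hy
        exact Fin.ext (hx.trans hy.symm)
    by_cases ht2 : t ≤ 2 * k
    · simp only [program, if_neg ht0, if_neg ht1, if_pos ht2]
      refine le_trans (Finset.sum_le_sum (g := fun j : Fin M => if j.val / q = i.val then 1 else 0)
        fun j _ => ?_) (le_trans ?_ hqS)
      · by_cases h : i.val = j.val / q
        · simp [h]
        · simp [h]
      · rw [← Finset.card_filter]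
        exact card_fin_div_eq_le hq i
    by_cases ht3 : t = 2 * k + 1
    · subst ht3
      have h2 := hdown (k - 1) (by omega)
      rw [show k + (k - 1) + 2 = 2 * k + 1 by omega, show k - 1 + 1 = k by omega] at h2
      rw [h2]
      simp only [send_proposals q k L f hA]
      refine (sum_length_proposalsFor_le q M _ _).trans ((proposers_le hin hq _ i).trans ?_)
      omega
    · simp [program, ht0, ht1, ht2, ht3]

/-- At the root the subtree of height k contains all machines, so its tallies are the exact values
of `crossing`. -/
theorem crossing_le_bestSeed (hin : IsEdgeDistribution G S input) (hk : 0 < k) (hL : 0 < L)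
    (hM : ∀ v : Fin n, owner q v < M) (hMk : M ≤ q ^ k) (i₀ : Fin M) {s : ℕ} (hs : s < L) :
    crossing G (f s) ≤
      crossing G (f (bestSeed q k L f (gathered q input) (ancestor q k i₀))) := by
  have hA := unpair_of_mem_gathered (q := q) hin
  have htally : ∀ s < L, tally s (upMem q L f (gathered q input) (k - 1) (ancestor q k i₀)) =
      crossing G (f s) := by
    intro s hs
    rw [tally_upMem q L f hA _ _ hs, Nat.sub_add_cancel hk, subtotal, Finset.filter_true_of_mem,
      sum_proposers hin hM]
    intro i _
    exact congrArg Fin.val (ancestor_eq hMk i i₀)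
  obtain ⟨h1, h2⟩ := best_spec hL
    (fun s => tally s (upMem q L f (gathered q input) (k - 1) (ancestor q k i₀)))
  rw [← htally s hs, ← htally _ (bestSeed_lt f hL _ _)]
  exact h2 s hs

theorem exists_matching_program (hin : IsEdgeDistribution G S input) (hG : G.maxDegree ≤ 2)
    (hM : ∀ v : Fin n, owner q v < M) (hMk : M ≤ q ^ k) (i₀ : Fin M) :
    ∃ N : G.Subgraph, N.IsMatching ∧
      N.edgeSet = listedEdges
        (fun j => accepted n (proposedMem q k L f (gathered q input) j)) ∧
      crossing G (f (bestSeed q k L f (gathered q input) (ancestor q k i₀))) ≤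
        2 * N.edgeSet.ncard := by
  set g := f (bestSeed q k L f (gathered q input) (ancestor q k i₀)) with hg
  have hmem : ∀ (j : Fin M) (v u : Fin n),
      arcWord v u ∈ proposedMem q k L f (gathered q input) j ↔
        owner q v = j ∧ proposal g (gathered q input ⟨owner q u, hM u⟩) u = some v := by
    intro j v u
    rw [mem_proposedMem f hMk (i₀ := i₀)]
    constructor
    · rintro ⟨i, u', v', h, hv, he⟩
      obtain ⟨rfl, rfl⟩ := arcWord_inj.1 he
      have : (⟨owner q u, hM u⟩ : Fin M) = i := Fin.ext (proposal_eq_some hin h).2.1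
      exact ⟨hv, this ▸ h⟩
    · rintro ⟨hv, h⟩
      exact ⟨_, u, v, h, hv, rfl⟩
  obtain ⟨N, h1, h2, h3⟩ := exists_matching_of_proposals G hG g
    (fun u => proposal g (gathered q input ⟨owner q u, hM u⟩) u)
    (fun v => (List.finRange n).find? fun u =>
      decide (arcWord v u ∈ proposedMem q k L f (gathered q input) ⟨owner q v, hM v⟩))
    (fun u v h => by
      obtain ⟨h1, -, h2⟩ := proposal_eq_some hin h
      exact ⟨h1, h2⟩)
    (fun v u h => by
      have := List.find?_some h
      rw [decide_eq_true_eq, hmem] at this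
      exact this.2)
    (fun u v h => by
      rw [List.find?_isSome]
      exact ⟨u, List.mem_finRange u, decide_eq_true ((hmem _ _ _).2 ⟨rfl, h⟩)⟩)
  refine ⟨N, h1, ?_, ?_⟩
  · rw [h2]
    ext e
    constructor
    · rintro ⟨v, u, h, rfl⟩
      exact ⟨⟨owner q v, hM v⟩, (v, u), (mem_accepted _ v u).2 h, rfl⟩
    · rintro ⟨j, ⟨v, u⟩, h, rfl⟩
      rw [mem_accepted] at h
      have hj := List.find?_some h
      rw [decide_eq_true_eq, hmem] at hj
      obtain rfl : (⟨owner q v, hM v⟩ : Fin M) = j := Fin.ext hj.1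
      exact ⟨v, u, h, rfl⟩
  · refine le_trans (le_of_eq ?_) h3
    rw [crossing]
    congr 1
    ext u
    simp only [Finset.mem_filter, Finset.mem_univ, true_and, isSome_proposal_iff hin]

/-- Pairing at most squares the size bound; two nested pairings give the exponent 4A for words. -/
theorem pair_lt_pow {n A a b : ℕ} (ha : a < (n + 2) ^ A) (hb : b < (n + 2) ^ A) :
    Nat.pair a b < (n + 2) ^ (2 * A) := by
  refine (Nat.pair_lt_max_add_one_sq a b).trans_le ?_
  rw [mul_comm, pow_mul]
  exact Nat.pow_le_pow_left (Nat.succ_le_of_lt (max_lt ha hb)) 2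

theorem arcWord_lt {A : ℕ} (hA : 0 < A) (u v : Fin n) : arcWord u v < (n + 2) ^ (4 * A) := by
  have h : ∀ u : Fin n, u.val < (n + 2) ^ A := fun u =>
    (u.2.trans (Nat.lt_add_of_pos_right two_pos)).trans_le (Nat.le_self_pow hA.ne' _)
  rw [show 4 * A = 2 * (2 * A) by ring]
  exact pair_lt_pow (pow_pos (by omega) _) (pair_lt_pow (h u) (h v))

theorem tallyWord_lt {A s c : ℕ} (hA : 0 < A) (hs : s < (n + 2) ^ A) (hc : c ≤ n) :
    tallyWord s c < (n + 2) ^ (4 * A) := by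
  rw [show 4 * A = 2 * (2 * A) by ring]
  refine pair_lt_pow (Nat.one_lt_pow (by omega) (by omega)) (pair_lt_pow hs ?_)
  exact (show c < n + 2 by omega).trans_le (Nat.le_self_pow hA.ne' _)

end Final

end PathMatching

/-! ### Choice of parameters and the main theorem. -/

open PathMatching in
theorem mainTheorem5 (δ : ℝ) (hδ : 0 < δ) :
    ∃ (C c R : ℕ) (S M : ℕ → ℕ) (P : (n : ℕ) → MPCProgram (M n)),
      ∀ n : ℕ, 1 ≤ n →
        -- local space, global space, and room for `n` edges (two words each) in the whole system
        (S n : ℝ) ≤ C * (n : ℝ) ^ δ ∧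
        S n * M n ≤ C * n ∧
        n ≤ M n * (S n / 2) ∧
        ∀ (G : SimpleGraph (Fin n)) [DecidableRel G.Adj], G.maxDegree ≤ 2 →
          ∀ input : Fin (M n) → List (Fin n × Fin n), IsEdgeDistribution G (S n) input →
            (P n).RunsWithin (S n) ((n + 2) ^ c) R (fun i => encodeEdges (input i)) ∧
            ∃ output : Fin (M n) → List (Fin n × Fin n),
              (∀ i, (P n).run (fun i => encodeEdges (input i)) R i = encodeEdges (output i)) ∧
              ∃ N : G.Subgraph, N.IsMatching ∧ N.edgeSet = listedEdges output ∧
                (G.edgeFinset.card : ℝ) / 8 ≤ (N.edgeSet.ncard : ℝ) := by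
  obtain ⟨k, hk2, hkδ⟩ : ∃ k : ℕ, 2 ≤ k ∧ (2 / k : ℝ) ≤ δ := by
    obtain ⟨k, hk⟩ := exists_nat_ge (2 / δ)
    refine ⟨k + 2, by omega, ?_⟩
    rw [div_le_iff₀ (by positivity)]
    rw [div_le_iff₀ hδ] at hk
    push_cast
    nlinarith
  have hk0 : k ≠ 0 := by omega
  have hq : ∀ n, 0 < rootSucc k n := fun n => Nat.succ_pos _
  have hqk : ∀ n, n < rootSucc k n ^ k := lt_rootSucc_pow hk0
  choose f hf using fun n => exists_bipartition_family n (12 * k * rootSucc k n)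
    (pow_three_mul_four_pow_lt (hqk n))
  -- The local space is exactly 2q² + qL with L = 8 · 12kq = 96kq. The factor 5 comes from q² ·
  -- (⌊n/q²⌋ + 1) ≤ n + 4n, and the exponent 96k + 1 from L ≤ (n + 2)^(96k) · (n + 2).
  refine ⟨5 * (96 * k + 2), 4 * (96 * k + 1), 2 * k + 3, fun n => (96 * k + 2) * rootSucc k n ^ 2,
    fun n => n / rootSucc k n ^ 2 + 1,
    fun n => program _ (rootSucc k n) k (8 * (12 * k * rootSucc k n)) (f n), fun n hn => ?_⟩
  beta_reduce
  have hroot := rootSucc_le hk0 hn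
  have hsq := rootSucc_sq_le (k := k) hn
  have hsq' := rootSucc_sq_le_mul hk2 hn
  have hf' := hf n
  have hq0 := hq n
  have hqk0 := hqk n
  generalize f n = f₀ at *
  generalize rootSucc k n = q at *
  have hq2 : 0 < q ^ 2 := pow_pos hq0 2
  have hdm := Nat.div_add_mod n (q ^ 2)
  have hmod := Nat.mod_lt n hq2
  refine ⟨?_, ?_, ?_, ?_⟩
  · have h1 : (n : ℝ) ^ (2 / k : ℝ) ≤ (n : ℝ) ^ δ :=
      Real.rpow_le_rpow_of_exponent_le (by exact_mod_cast hn) hkδ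
    have h2 : (0 : ℝ) ≤ (n : ℝ) ^ δ := by positivity
    have h3 : (q : ℝ) ^ 2 ≤ 5 * (n : ℝ) ^ δ := by linarith
    push_cast
    calc (96 * (k : ℝ) + 2) * (q : ℝ) ^ 2 ≤ (96 * k + 2) * (5 * (n : ℝ) ^ δ) := by gcongr
      _ = 5 * (96 * k + 2) * (n : ℝ) ^ δ := by ring
  · calc (96 * k + 2) * q ^ 2 * (n / q ^ 2 + 1) = (96 * k + 2) * (q ^ 2 * (n / q ^ 2) + q ^ 2) := by
          ring
      _ ≤ (96 * k + 2) * (5 * n) := Nat.mul_le_mul_left _ (by have := Nat.mul_div_le n (q ^ 2); omega)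
      _ = 5 * (96 * k + 2) * n := by ring
  · have h1 : (96 * k + 2) * q ^ 2 / 2 = (48 * k + 1) * q ^ 2 := by
      rw [show (96 * k + 2) * q ^ 2 = 2 * ((48 * k + 1) * q ^ 2) by ring]
      exact Nat.mul_div_cancel_left _ two_pos
    rw [h1]
    calc n ≤ (n / q ^ 2 + 1) * q ^ 2 := by rw [add_mul, one_mul, mul_comm]; omega
      _ ≤ (n / q ^ 2 + 1) * ((48 * k + 1) * q ^ 2) :=
        Nat.mul_le_mul_left _ (Nat.le_mul_of_pos_left _ (by omega))
  · intro G _ hG input hin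
    have hh : 0 < 12 * k * q := Nat.mul_pos (by omega) hq0
    have hL : 0 < 8 * (12 * k * q) := by omega
    have hM : ∀ v : Fin n, owner q v < n / q ^ 2 + 1 := fun v =>
      Nat.lt_succ_of_le (Nat.div_le_div_right v.2.le)
    have hMk : n / q ^ 2 + 1 ≤ q ^ k := (Nat.succ_le_succ (Nat.div_le_self _ _)).trans hqk0
    have hA := unpair_of_mem_gathered (q := q) hin
    have hLB : 8 * (12 * k * q) ≤ (n + 2) ^ (96 * k + 1) := by
      have h1 : 96 * k ≤ (n + 2) ^ (96 * k) := (Nat.lt_pow_self (by omega)).le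
      calc 8 * (12 * k * q) = 96 * k * q := by ring
        _ ≤ (n + 2) ^ (96 * k) * (n + 2) := Nat.mul_le_mul h1 (by omega)
        _ = (n + 2) ^ (96 * k + 1) := (pow_succ _ _).symm
    have hS : 2 * q ^ 2 + q * (8 * (12 * k * q)) ≤ (96 * k + 2) * q ^ 2 := by
      apply le_of_eq; ring
    refine ⟨runsWithin_program f₀ hin hG hq0 (by omega) hL hM hMk hS ?_
      (arcWord_lt (by omega)) (fun s hs c hc => tallyWord_lt (by omega) (hs.trans_le hLB) hc),
      fun j => accepted n (proposedMem q k (8 * (12 * k * q)) f₀ (gathered q input) j), ?_, ?_⟩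
    · exact (Nat.le_add_right n 2).trans (Nat.le_self_pow (by omega) _)
    · intro i
      rw [run_accepted q k _ f₀ (by omega) hA (run_one q k _ f₀ input)]
    · obtain ⟨N, h1, h2, h3⟩ := exists_matching_program (L := 8 * (12 * k * q)) f₀ hin hG hM hMk
        ⟨0, Nat.succ_pos _⟩
      refine ⟨N, h1, h2, ?_⟩
      -- Every seed has at most 2|N| proposers, so m ≤ 4 · 2|N|.
      have h4 := card_edgeFinset_le_crossing hG hh hf' fun s hs =>
        (crossing_le_bestSeed f₀ hin (by omega) hL hM hMk ⟨0, Nat.succ_pos _⟩ hs).trans h3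
      have h5 : (G.edgeFinset.card : ℝ) ≤ 8 * N.edgeSet.ncard := by
        exact_mod_cast (show G.edgeFinset.card ≤ 8 * N.edgeSet.ncard by omega)
      linarith
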